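/- Let $G$ be an abelian group. Call a group topology on $G$ precompact if the completion of $G$ with respect to it is compact. The Bohr topology of $G$ is the strongest precompact group topology on $G$; $G^\#$ denotes $G$ with this topology, and the Bohr compactification $bG$ is the completion of $G^\#$, a compact abelian group containing (the canonical image of) $G$. Then: (a) for every infinite subset $X\subseteq G$, the closure of $X$ in $bG$ has cardinality at least $2^{\mathfrak c}$, where $\mathfrak c=|\mathbb R|$; (b) (Flor) no non-trivial sequence of points of $G$ converges in $bG$: if $(x_n)_{n\in\mathbb N}$ is a sequence in $G$ whose image in $bG$ converges to a point of $bG$, then $(x_n)$ is eventually constant; (c) (Glicksberg) $G^\#$ has no infinite compact subsets. -/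

import Mathlib

open UniformSpace Filter Topology

/-- A group topology on an abelian group is precompact (totally bounded) if the completion of the
group with respect to (the group uniformity of) that topology is compact. -/
def AddGroupTopology.IsPrecompact {G : Type*} [AddCommGroup G] (t : AddGroupTopology G) : Prop :=
  letI : TopologicalSpace G := t.toTopologicalSpace
  haveI : IsTopologicalAddGroup G := t.toIsTopologicalAddGroup
  letI : UniformSpace G := IsTopologicalAddGroup.rightUniformSpace G
  CompactSpace (Completion G)

/-- The Bohr topology of an abelian group: the strongest precompact group topology. Mathlib orders
topologies by reverse inclusion, so a supremum with respect to strength is an infimum here;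
`isLeast_bohrTopology` below shows that it is attained. -/
noncomputable def bohrTopology (G : Type*) [AddCommGroup G] : AddGroupTopology G :=
  sInf {t : AddGroupTopology G | t.IsPrecompact}

theorem compactSpace_completion_iff_totallyBounded {α : Type*} [UniformSpace α] :
    CompactSpace (Completion α) ↔ TotallyBounded (Set.univ : Set α) := by
  constructor
  · intro h
    have h1 : TotallyBounded (Set.univ : Set (Completion α)) := isCompact_univ.totallyBounded
    have h2 := totallyBounded_preimage (Completion.isUniformInducing_coe α) h1
    simpa using h2
  · intro h
    have h1 := (h.image (Completion.uniformContinuous_coe α)).closure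
    rw [Set.image_univ, (Completion.denseRange_coe (α := α)).closure_eq] at h1
    exact ⟨h1.isCompact_of_isClosed isClosed_univ⟩

/-- The Bohr topology is precompact, so it is the strongest precompact group topology. -/
theorem isLeast_bohrTopology (G : Type*) [AddCommGroup G] :
    IsLeast {t : AddGroupTopology G | t.IsPrecompact} (bohrTopology G) := by
  refine ⟨?_, fun t ht => sInf_le ht⟩
  let S : Set (AddGroupTopology G) := {t | t.IsPrecompact}
  let u : S → UniformSpace G := fun t =>
    @IsTopologicalAddGroup.rightUniformSpace G _ t.1.toTopologicalSpace t.1.toIsTopologicalAddGroup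
  have hu : ∀ t : S, @IsUniformAddGroup G (u t) _ := fun t => by
    let _ : TopologicalSpace G := t.1.toTopologicalSpace
    have _ : IsTopologicalAddGroup G := t.1.toIsTopologicalAddGroup
    exact isUniformAddGroup_of_addCommGroup
  have htb : ∀ t : S, @TotallyBounded G (u t) Set.univ := fun t =>
    (@compactSpace_completion_iff_totallyBounded G (u t)).1 t.2
  let v : UniformSpace G :=
    @IsTopologicalAddGroup.rightUniformSpace G _ (bohrTopology G).toTopologicalSpace
      (bohrTopology G).toIsTopologicalAddGroup
  have hv : @IsUniformAddGroup G v _ := by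
    let _ : TopologicalSpace G := (bohrTopology G).toTopologicalSpace
    have _ : IsTopologicalAddGroup G := (bohrTopology G).toIsTopologicalAddGroup
    exact isUniformAddGroup_of_addCommGroup
  have htop : v.toTopologicalSpace = (⨅ t, u t).toTopologicalSpace := by
    rw [UniformSpace.toTopologicalSpace_iInf]
    change sInf (AddGroupTopology.toTopologicalSpace '' S) = _
    rw [sInf_image']
    rfl
  have hvu : v = ⨅ t, u t :=
    IsUniformAddGroup.ext hv (isUniformAddGroup_iInf hu) (by rw [htop])
  refine (@compactSpace_completion_iff_totallyBounded G v).2 ?_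
  rw [hvu]
  refine (@totallyBounded_iff_ultrafilter G (⨅ t, u t) Set.univ).2 fun f hf => ?_
  refine (cauchy_iInf_uniformSpace' (u := u)).2 fun t => ?_
  exact (@totallyBounded_iff_ultrafilter G (u t) Set.univ).1 (htb t) f hf

/-- `BohrGroup G` is the abelian group `G` equipped with its Bohr topology (often written `G^#`). -/
def BohrGroup (G : Type*) : Type _ := G

namespace BohrGroup

instance instAddCommGroup (G : Type*) [h : AddCommGroup G] : AddCommGroup (BohrGroup G) := h

noncomputable instance instTopologicalSpace (G : Type*) [AddCommGroup G] :
    TopologicalSpace (BohrGroup G) :=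
  (bohrTopology G).toTopologicalSpace

instance instIsTopologicalAddGroup (G : Type*) [AddCommGroup G] :
    IsTopologicalAddGroup (BohrGroup G) :=
  (bohrTopology G).toIsTopologicalAddGroup

/-- The group uniformity; its topology is the Bohr topology. -/
noncomputable instance instUniformSpace (G : Type*) [AddCommGroup G] :
    UniformSpace (BohrGroup G) :=
  IsTopologicalAddGroup.rightUniformSpace (BohrGroup G)

instance instIsUniformAddGroup (G : Type*) [AddCommGroup G] : IsUniformAddGroup (BohrGroup G) :=
  isUniformAddGroup_of_addCommGroup

/-- The identity isomorphism of groups from `G` to `BohrGroup G`. -/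
def of (G : Type*) [AddCommGroup G] : G ≃+ BohrGroup G := AddEquiv.refl G

end BohrGroup

/-- The Bohr compactification `bG`: the (Hausdorff) completion of `G` with its Bohr topology.
It carries Mathlib's topological group structure on completions. -/
abbrev BohrCompactification (G : Type*) [AddCommGroup G] : Type _ := Completion (BohrGroup G)

instance BohrCompactification.instCompactSpace (G : Type*) [AddCommGroup G] :
    CompactSpace (BohrCompactification G) :=
  (isLeast_bohrTopology G).1

/-- The canonical homomorphism `G → bG`. -/
noncomputable def BohrCompactification.of (G : Type*) [AddCommGroup G] :
    G →+ BohrCompactification G :=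
  Completion.toCompl.comp (BohrGroup.of G).toAddMonoidHom

/-! Everything is read off the characters of G, which extend continuously to bG. In the compact
dual, a nonempty open set of characters can be nearly constant at only finitely many points of G.
Hence an infinite X contains a sequence on which characters realise every 0-1 pattern, up to two
disjoint closed sets of values. Feeding in an independent family of continuum many patterns and
using compactness of bG yields a point of the closure of X for each of the 2^𝔠 choices of sides. A
convergent sequence has countable closure, hence finite range. A compact subset of G^# traps the
closure of a countable subset X inside G; characters vanishing on the subgroup generated by X then
confine it to that countable subgroup. -/

theorem AddCircle.norm_two_nsmul_of_norm_lt {t : AddCircle (1 : ℝ)} (ht : ‖t‖ < 1 / 4) :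
    ‖2 • t‖ = 2 * ‖t‖ := by
  obtain ⟨x, rfl⟩ := QuotientAddGroup.mk_surjective t
  change ‖(x : AddCircle (1 : ℝ))‖ < 1 / 4 at ht
  change ‖2 • (x : AddCircle (1 : ℝ))‖ = 2 * ‖(x : AddCircle (1 : ℝ))‖
  have hr : (x : AddCircle (1 : ℝ)) = ((x - round x : ℝ) : AddCircle (1 : ℝ)) := by
    rw [eq_comm, ← sub_eq_zero, ← AddCircle.coe_sub, AddCircle.coe_eq_zero_iff]
    exact ⟨-round x, by simp⟩
  have hle := abs_sub_round x
  rw [hr] at ht ⊢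
  have hn : ‖((x - round x : ℝ) : AddCircle (1 : ℝ))‖ = |x - round x| :=
    (AddCircle.norm_coe_eq_abs_iff 1 one_ne_zero).2 (by simpa using hle)
  rw [hn] at ht ⊢
  rw [← AddCircle.coe_nsmul, nsmul_eq_mul,
    (AddCircle.norm_coe_eq_abs_iff 1 one_ne_zero).2] <;>
  · rw [abs_mul]
    norm_num
    try linarith

/-- Doubling doubles the norm below 1/4, so the norms for a nonzero t would grow without bound. -/
theorem AddCircle.eq_zero_of_norm_two_pow_nsmul_lt {t : AddCircle (1 : ℝ)}
    (ht : ∀ k : ℕ, ‖2 ^ k • t‖ < 1 / 4) : t = 0 := by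
  have h : ∀ k : ℕ, ‖2 ^ k • t‖ = 2 ^ k * ‖t‖ := by
    intro k
    induction k with
    | zero => simp
    | succ k ih =>
      rw [pow_succ', mul_nsmul', AddCircle.norm_two_nsmul_of_norm_lt (ht k), ih]
      ring
  by_contra h0
  have hpos : 0 < ‖t‖ := norm_pos_iff.2 h0
  obtain ⟨k, hk⟩ := pow_unbounded_of_one_lt (1 / ‖t‖) (one_lt_two (α := ℝ))
  have h1 := ht k
  rw [h k] at h1
  rw [div_lt_iff₀ hpos] at hk
  linarith

theorem exists_finset_dist_lt_of_compactSpace {α M : Type*} [PseudoMetricSpace M] [CompactSpace M]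
    (g : α → M) {ε : ℝ} (hε : 0 < ε) : ∃ t : Finset α, ∀ a, ∃ b ∈ t, dist (g a) (g b) < ε := by
  have h : TotallyBounded (Set.range g) := isCompact_univ.totallyBounded.subset (Set.subset_univ _)
  obtain ⟨s, hs, hf, hcov⟩ := totallyBounded_iff_subset.1 h _ (Metric.dist_mem_uniformity hε)
  classical
  obtain ⟨u, rfl⟩ := hf.exists_finset_coe
  rw [← Set.image_univ] at hs
  obtain ⟨t, -, rfl⟩ := Finset.subset_set_image_iff.1 hs
  refine ⟨t, fun a => ?_⟩
  simpa using hcov (Set.mem_range_self a)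

/-- The homomorphisms from an abelian group to the circle `ℝ / ℤ`, with the topology of pointwise
convergence. -/
def CircleDual (G : Type*) [AddCommGroup G] : Type _ := G →+ AddCircle (1 : ℝ)

/-! ### The compact dual and polars of open sets -/

namespace CircleDual

variable {G : Type*} [AddCommGroup G]

noncomputable instance : AddCommGroup (CircleDual G) :=
  inferInstanceAs (AddCommGroup (G →+ AddCircle (1 : ℝ)))

instance : FunLike (CircleDual G) G (AddCircle (1 : ℝ)) :=
  inferInstanceAs (FunLike (G →+ AddCircle (1 : ℝ)) G (AddCircle (1 : ℝ)))

instance : AddMonoidHomClass (CircleDual G) G (AddCircle (1 : ℝ)) :=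
  inferInstanceAs (AddMonoidHomClass (G →+ AddCircle (1 : ℝ)) G (AddCircle (1 : ℝ)))

theorem add_apply (χ ψ : CircleDual G) (x : G) : (χ + ψ) x = χ x + ψ x := rfl

theorem sub_apply (χ ψ : CircleDual G) (x : G) : (χ - ψ) x = χ x - ψ x := rfl

theorem nsmul_apply (n : ℕ) (χ : CircleDual G) (x : G) : (n • χ) x = n • χ x := rfl

instance : TopologicalSpace (CircleDual G) := .induced (fun χ x => χ x) inferInstance

instance : CompactSpace (CircleDual G) := by
  have h : IsClosedEmbedding (fun (χ : CircleDual G) (x : G) => χ x) :=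
    ⟨⟨⟨rfl⟩, DFunLike.coe_injective⟩, AddMonoidHom.isClosed_range_coe G (AddCircle (1 : ℝ))⟩
  exact h.compactSpace

theorem continuous_eval (x : G) : Continuous fun χ : CircleDual G => χ x :=
  (continuous_apply x).comp continuous_induced_dom

/-- Characters into ℚ/ℤ separate points, and ℚ/ℤ embeds in ℝ/ℤ. -/
theorem exists_apply_ne_zero {x : G} (hx : x ≠ 0) : ∃ χ : CircleDual G, χ x ≠ 0 := by
  obtain ⟨c, hc⟩ := CharacterModule.exists_character_apply_ne_zero_of_ne_zero hx
  have hmap : AddSubgroup.zmultiples (1 : ℚ) ≤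
      (AddSubgroup.zmultiples (1 : ℝ)).comap (Rat.castHom ℝ).toAddMonoidHom := by
    rw [AddSubgroup.zmultiples_le]
    simp
  let f : AddCircle (1 : ℚ) →+ AddCircle (1 : ℝ) := QuotientAddGroup.map _ _ _ hmap
  refine ⟨f.comp c, fun h => hc ?_⟩
  change f (c x) = 0 at h
  obtain ⟨q, hq⟩ := QuotientAddGroup.mk_surjective (c x)
  rw [← hq] at h ⊢
  change ((((q : ℚ) : ℝ)) : AddCircle (1 : ℝ)) = 0 at h
  change (q : AddCircle (1 : ℚ)) = 0
  rw [AddCircle.coe_eq_zero_iff] at h ⊢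
  obtain ⟨n, hn⟩ := h
  refine ⟨n, ?_⟩
  simp only [zsmul_eq_mul, mul_one] at hn ⊢
  exact_mod_cast hn

theorem exists_finset_of_isOpen {U : Set (CircleDual G)} (hU : IsOpen U) {χ : CircleDual G}
    (hχ : χ ∈ U) : ∃ (F : Finset G) (ε : ℝ), 0 < ε ∧
      ∀ ψ : CircleDual G, (∀ x ∈ F, ‖ψ x‖ < ε) → χ + ψ ∈ U := by
  obtain ⟨V, hV, rfl⟩ := isOpen_induced_iff.1 hU
  obtain ⟨F, u, hu, hsub⟩ := isOpen_pi_iff.1 hV _ hχ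
  have h : ∀ᶠ ε in 𝓝[>] (0 : ℝ), ∀ x ∈ F, Metric.ball (χ x) ε ⊆ u x := by
    rw [Finset.eventually_all]
    intro x hx
    obtain ⟨ε, hε, hb⟩ := Metric.isOpen_iff.1 (hu x hx).1 _ (hu x hx).2
    filter_upwards [Ioo_mem_nhdsGT hε] with δ hδ
    exact (Metric.ball_subset_ball hδ.2.le).trans hb
  obtain ⟨ε, hF, hε⟩ := (h.and self_mem_nhdsWithin).exists
  refine ⟨F, ε, hε, fun ψ hψ => hsub fun x hx => hF x hx ?_⟩
  change dist (χ x + ψ x) (χ x) < ε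
  simpa [dist_eq_norm] using hψ x hx

/-- The polar of a nonempty open set of characters is finite. -/
theorem finite_setOf_norm_sub_lt {U : Set (CircleDual G)} (hU : IsOpen U) (hne : U.Nonempty) :
    {x : G | ∀ χ ∈ U, ∀ ψ ∈ U, ‖χ x - ψ x‖ < 1 / 4}.Finite := by
  obtain ⟨χ₀, hχ₀⟩ := hne
  obtain ⟨F, ε, hε, hF⟩ := exists_finset_of_isOpen hU hχ₀
  by_contra hinf
  set W := {x : G | ∀ χ ∈ U, ∀ ψ ∈ U, ‖χ x - ψ x‖ < 1 / 4} with hW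
  have hV : ∀ ψ : CircleDual G, (∀ f ∈ F, ‖ψ f‖ < ε) → ∀ x ∈ W, ‖ψ x‖ < 1 / 4 := by
    intro ψ hψ x hx
    have := hx _ (hF ψ hψ) _ hχ₀
    simpa [add_apply] using this
  have hV' : ∀ ψ : CircleDual G, (∀ f ∈ F, ‖ψ f‖ < ε / 4) → ∀ x ∈ W, ‖ψ x‖ < 1 / 16 := by
    intro ψ hψ x hx
    have hmul : ∀ n : ℕ, n ≤ 4 → ‖n • ψ x‖ < 1 / 4 := by
      intro n hn
      refine hV (n • ψ) (fun f hf => ?_) x hx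
      have hn' : (n : ℝ) ≤ 4 := by exact_mod_cast hn
      calc ‖n • ψ f‖ ≤ n * ‖ψ f‖ := norm_nsmul_le
        _ ≤ 4 * ‖ψ f‖ := by gcongr
        _ < ε := by linarith [hψ f hf]
    have h1 := hmul 1 (by norm_num)
    have h2 := hmul 2 (by norm_num)
    have h4 := hmul 4 (by norm_num)
    rw [one_nsmul] at h1
    rw [show 4 = 2 * 2 from rfl, mul_nsmul', AddCircle.norm_two_nsmul_of_norm_lt h2,
      AddCircle.norm_two_nsmul_of_norm_lt h1] at h4
    linarith
  obtain ⟨t, ht⟩ := exists_finset_dist_lt_of_compactSpace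
    (fun (χ : CircleDual G) (f : F) => χ f) (show 0 < ε / 4 by linarith)
  obtain ⟨s, hs⟩ := exists_finset_dist_lt_of_compactSpace
    (fun (x : W) (χ : t) => (χ : CircleDual G) (x : G)) (show (0 : ℝ) < 1 / 16 by norm_num)
  choose b hbs hb using hs
  have : Infinite W := Set.infinite_coe_iff.2 hinf
  -- Pigeonhole: some x ≠ y agree within 1/8 under every character of the finite net `t`. Each 2^k •
  -- χ is within 1/16 of a net member on W, so its value at x - y is below 1/8 + 1/16 + 1/16 = 1/4.
  obtain ⟨x, -, y, -, hxy, hbxy⟩ := (Set.infinite_univ (α := W)).exists_ne_map_eq_of_mapsTo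
    (f := b) (t := (s : Set W)) (fun x _ => hbs x) s.finite_toSet
  refine hxy (Subtype.ext (sub_eq_zero.1 ?_))
  by_contra h0
  obtain ⟨χ, hχ⟩ := exists_apply_ne_zero h0
  refine hχ (AddCircle.eq_zero_of_norm_two_pow_nsmul_lt fun k => ?_)
  obtain ⟨φ, hφt, hφ⟩ := ht (2 ^ k • χ)
  have hd : ∀ z ∈ W, ‖(2 ^ k • χ - φ) z‖ < 1 / 16 := by
    refine hV' _ fun f hf => ?_
    have := (dist_pi_lt_iff (by linarith)).1 hφ ⟨f, hf⟩
    rwa [dist_eq_norm] at this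
  have hx := hd x x.2
  have hy := hd y y.2
  have hx' := (dist_pi_lt_iff (by norm_num)).1 (hb x) ⟨φ, hφt⟩
  have hy' := (dist_pi_lt_iff (by norm_num)).1 (hb y) ⟨φ, hφt⟩
  rw [← hbxy] at hy'
  have hxy' := (dist_triangle_right (φ x) (φ y) (φ (b x))).trans_lt (add_lt_add hx' hy')
  rw [dist_eq_norm] at hxy'
  rw [map_sub, smul_sub, ← nsmul_apply, ← nsmul_apply]
  have heq : (2 ^ k • χ) (x : G) - (2 ^ k • χ) (y : G) =
      (φ x - φ y) + ((2 ^ k • χ - φ) x - (2 ^ k • χ - φ) y) := by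
    simp only [sub_apply]; abel
  rw [heq]
  have h3 := norm_add_le (φ x - φ y) ((2 ^ k • χ - φ) x - (2 ^ k • χ - φ) y)
  have h4 := norm_sub_le ((2 ^ k • χ - φ) x) ((2 ^ k • χ - φ) y)
  linarith

end CircleDual

/-! ### Interpolation along a sequence -/

namespace CircleDual

variable {G : Type*} [AddCommGroup G]

/-- Otherwise U can be shrunk once for each pair of far-apart net points, until for `l`-most x the
values at x of characters in U miss one point of every pair. But for cofinitely many x these values
spread by at least 1/4. -/
theorem exists_eventually_inter_nonempty (l : Ultrafilter G) (hl : (l : Filter G) ≤ cofinite) :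
    ∃ (c : Bool → AddCircle (1 : ℝ)) (U : Set (CircleDual G)), 1 / 8 < dist (c true) (c false) ∧
      IsOpen U ∧ U.Nonempty ∧ ∀ V ⊆ U, IsOpen V → V.Nonempty →
        ∀ b, ∀ᶠ x in (l : Filter G), (V ∩ {χ | dist (χ x) (c b) < 1 / 16}).Nonempty := by
  obtain ⟨T, hT⟩ := exists_finset_dist_lt_of_compactSpace (id : AddCircle (1 : ℝ) → _)
    (show (0 : ℝ) < 1 / 32 by norm_num)
  simp only [id] at hT
  -- As `l` is an ultrafilter, a property that fails to hold eventually eventually fails.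
  by_contra! hcon
  have key : ∀ S : Finset (Bool → AddCircle (1 : ℝ)), ∃ U : Set (CircleDual G), IsOpen U ∧
      U.Nonempty ∧ ∀ c ∈ S, 1 / 8 < dist (c true) (c false) →
        ∃ b, ∀ᶠ x in (l : Filter G), U ∩ {χ | dist (χ x) (c b) < 1 / 16} = ∅ := by
    intro S
    classical
    induction S using Finset.induction_on with
    | empty => exact ⟨Set.univ, isOpen_univ, Set.univ_nonempty, by simp⟩
    | insert c S _ ih =>
      obtain ⟨U, hU, hne, hS⟩ := ih
      by_cases hc : 1 / 8 < dist (c true) (c false)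
      · obtain ⟨V, hVU, hV, hVne, b, hb⟩ := hcon c U hc hU hne
        refine ⟨V, hV, hVne, fun d hd hdd => ?_⟩
        rcases Finset.mem_insert.1 hd with rfl | hd
        · exact ⟨b, hb⟩
        · obtain ⟨b', hb'⟩ := hS d hd hdd
          refine ⟨b', hb'.mono fun x hx => ?_⟩
          exact Set.subset_empty_iff.1 (hx ▸ Set.inter_subset_inter_left _ hVU)
      · refine ⟨U, hU, hne, fun d hd hdd => ?_⟩
        rcases Finset.mem_insert.1 hd with rfl | hd
        · exact absurd hdd hc
        · exact hS d hd hdd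
  obtain ⟨U, hU, hne, hS⟩ := key (Fintype.piFinset fun _ => T)
  have hfin := hl (finite_setOf_norm_sub_lt hU hne).compl_mem_cofinite
  have hall : ∀ᶠ x in (l : Filter G), ∀ c ∈ Fintype.piFinset fun _ : Bool => T,
      1 / 8 < dist (c true) (c false) →
        ∃ b, U ∩ {χ | dist (χ x) (c b) < 1 / 16} = ∅ := by
    rw [Finset.eventually_all]
    intro c hc
    by_cases hd : 1 / 8 < dist (c true) (c false)
    · obtain ⟨b, hb⟩ := hS c hc hd
      exact hb.mono fun x hx _ => ⟨b, hx⟩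
    · exact Eventually.of_forall fun x h => absurd h hd
  obtain ⟨x, hx, hxS⟩ := (Filter.Eventually.and hfin hall).exists
  simp only [Set.mem_ofPred_eq, not_forall, not_lt] at hx
  obtain ⟨χ, hχ, ψ, hψ, hχψ⟩ := hx
  obtain ⟨p, hp, hpχ⟩ := hT (χ x)
  obtain ⟨q, hq, hqψ⟩ := hT (ψ x)
  rw [← dist_eq_norm] at hχψ
  have h4 := dist_triangle4 (χ x) p q (ψ x)
  rw [dist_comm q] at h4
  obtain ⟨b, hb⟩ := hxS (fun b => bif b then p else q)
    (Fintype.mem_piFinset.2 fun b => by cases b <;> assumption) (by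
      change 1 / 8 < dist p q
      linarith)
  cases b
  · exact (hb ▸ (⟨hψ, hqψ.trans (by norm_num)⟩ : ψ ∈ U ∩ {χ | dist (χ x) q < 1 / 16}) : ψ ∈ (∅ : Set _))
  · exact (hb ▸ (⟨hχ, hpχ.trans (by norm_num)⟩ : χ ∈ U ∩ {χ | dist (χ x) p < 1 / 16}) : χ ∈ (∅ : Set _))

/-- Every infinite subset of an abelian group contains a sequence on which all two-valued patterns
are interpolated by characters, up to a fixed small error. -/
theorem exists_interpolating_seq {X : Set G} (hX : X.Infinite) :
    ∃ (y : ℕ → G) (K : Bool → Set (AddCircle (1 : ℝ))), (∀ n, y n ∈ X) ∧ (∀ b, IsClosed (K b)) ∧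
      Disjoint (K true) (K false) ∧ ∀ A : ℕ → Bool, ∃ χ : CircleDual G, ∀ n, χ (y n) ∈ K (A n) := by
  have : (cofinite ⊓ 𝓟 X).NeBot := hX.cofinite_inf_principal_neBot
  let l : Ultrafilter G := Ultrafilter.of (cofinite ⊓ 𝓟 X)
  have hl : (l : Filter G) ≤ cofinite ⊓ 𝓟 X := Ultrafilter.of_le _
  obtain ⟨c, U, hc, hU, hUne, h⟩ := exists_eventually_inter_nonempty l (hl.trans inf_le_left)
  have hXl : X ∈ (l : Filter G) := hl.trans inf_le_right (mem_principal_self X)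
  let P : ((ℕ → Bool) → Set (CircleDual G)) → Prop := fun S =>
    (Set.range S).Finite ∧ ∀ A, IsOpen (S A) ∧ (S A).Nonempty ∧ S A ⊆ U
  have hstep : ∀ S, P S → ∃ x ∈ X, ∀ A b, (S A ∩ {χ | dist (χ x) (c b) < 1 / 16}).Nonempty := by
    rintro S ⟨hfin, hS⟩
    have h1 : ∀ᶠ x in (l : Filter G), ∀ V ∈ Set.range S, ∀ b : Bool,
        (V ∩ {χ | dist (χ x) (c b) < 1 / 16}).Nonempty := by
      rw [eventually_all_finite hfin]
      rintro _ ⟨A, rfl⟩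
      rw [eventually_all]
      exact h _ (hS A).2.2 (hS A).1 (hS A).2.1
    obtain ⟨x, hx, hxX⟩ := (h1.and hXl).exists
    exact ⟨x, hxX, fun A b => hx _ ⟨A, rfl⟩ b⟩
  obtain ⟨x₀, hx₀⟩ := hX.nonempty
  have hstep' : ∀ S, ∃ x ∈ X, P S → ∀ A b, (S A ∩ {χ | dist (χ x) (c b) < 1 / 16}).Nonempty := by
    intro S
    by_cases hS : P S
    · obtain ⟨x, hx, hxS⟩ := hstep S hS
      exact ⟨x, hx, fun _ => hxS⟩
    · exact ⟨x₀, hx₀, fun h => absurd h hS⟩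
  choose Y hYX hY using hstep'
  -- `S n A` depends only on the first n bits of A, so only finitely many open sets occur at stage n
  -- and one point serves them all.
  let S : ℕ → (ℕ → Bool) → Set (CircleDual G) := fun n => Nat.rec (fun _ => U)
    (fun n S A => S A ∩ {χ | dist (χ (Y S)) (c (A n)) < 1 / 16}) n
  have hS : ∀ n A, S (n + 1) A = S n A ∩ {χ | dist (χ (Y (S n))) (c (A n)) < 1 / 16} :=
    fun _ _ => rfl
  have hP : ∀ n, P (S n) := by
    intro n
    induction n with
    | zero => exact ⟨Set.finite_range_const, fun A => ⟨hU, hUne, subset_rfl⟩⟩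
    | succ n ih =>
      refine ⟨?_, fun A => ⟨?_, ?_, ?_⟩⟩
      · refine ((ih.1.prod (Set.toFinite (Set.univ : Set Bool))).image fun p =>
          p.1 ∩ {χ | dist (χ (Y (S n))) (c p.2) < 1 / 16}).subset ?_
        rintro _ ⟨A, rfl⟩
        exact ⟨(S n A, A n), ⟨⟨A, rfl⟩, Set.mem_univ _⟩, rfl⟩
      · rw [hS]
        exact (ih.2 A).1.inter (isOpen_lt ((continuous_eval _).dist continuous_const)
          continuous_const)
      · exact hY _ ih A (A n)
      · exact Set.inter_subset_left.trans (ih.2 A).2.2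
  refine ⟨fun n => Y (S n), fun b => Metric.closedBall (c b) (1 / 16), fun n => hYX _,
    fun b => Metric.isClosed_closedBall, Metric.closedBall_disjoint_closedBall (by linarith), ?_⟩
  intro A
  obtain ⟨χ, hχ⟩ := IsCompact.nonempty_iInter_of_sequence_nonempty_isCompact_isClosed
    (fun n => closure (S n A)) (fun n => closure_mono Set.inter_subset_left)
    (fun n => ((hP n).2 A).2.1.closure) isClosed_closure.isCompact (fun n => isClosed_closure)
  refine ⟨χ, fun n => ?_⟩
  have h1 : closure (S (n + 1) A) ⊆ {χ | dist (χ (Y (S n))) (c (A n)) ≤ 1 / 16} := by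
    refine closure_minimal (fun χ hχ => ?_)
      (isClosed_le ((continuous_eval _).dist continuous_const) continuous_const)
    rw [hS] at hχ
    exact le_of_lt (Set.mem_ofPred_eq ▸ hχ.2)
  exact h1 (Set.mem_iInter.1 hχ (n + 1))

end CircleDual

/-- There is a family of continuum many independent subsets of `ℕ`, indexed by `Set ℕ`. -/
theorem exists_independent_family : ∃ I : Set ℕ → ℕ → Bool,
    ∀ (R : Finset (Set ℕ)) (τ : Set ℕ → Bool), ∃ n, ∀ r ∈ R, I r n = τ r := by
  classical
  -- Hausdorff's construction: n codes a finite F and a family of subsets of F; r takes the value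
  -- true at n when its trace on F is in the family.
  obtain ⟨e, he⟩ := exists_surjective_nat (Finset ℕ × Finset (Finset ℕ))
  let tr : Finset ℕ → Set ℕ → Finset ℕ := fun F r => F.filter (· ∈ r)
  refine ⟨fun r n => decide (tr (e n).1 r ∈ (e n).2), fun R τ => ?_⟩
  have hsep : ∀ r s : Set ℕ, ∃ k, r ≠ s → ¬(k ∈ r ↔ k ∈ s) := by
    intro r s
    by_contra! h
    obtain ⟨hne, -⟩ := h 0
    exact hne (Set.ext fun k => (h k).2)
  choose d hd using hsep
  let F : Finset ℕ := (R ×ˢ R).image fun p => d p.1 p.2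
  have hF : ∀ r ∈ R, ∀ s ∈ R, tr F r = tr F s → r = s := by
    intro r hr s hs h
    by_contra hne
    have hk : d r s ∈ F := Finset.mem_image.2 ⟨(r, s), Finset.mem_product.2 ⟨hr, hs⟩, rfl⟩
    refine hd r s hne ?_
    have := Finset.ext_iff.1 h (d r s)
    simpa [tr, hk] using this
  obtain ⟨n, hn⟩ := he (F, (R.filter (τ · = true)).image (tr F))
  refine ⟨n, fun r hr => ?_⟩
  beta_reduce
  rw [hn, Bool.eq_iff_iff]
  simp only [decide_eq_true_eq, Finset.mem_image, Finset.mem_filter]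
  constructor
  · rintro ⟨s, ⟨hs, hτ⟩, h⟩
    rwa [← hF s hs r hr h]
  · exact fun h => ⟨r, ⟨hr, h⟩, rfl⟩

/-! ### Extending characters to bG -/

namespace CircleDual

variable {G : Type*} [AddCommGroup G]

/-- The topology pulled back from the compact circle is precompact, hence coarser than the Bohr
topology. -/
theorem continuous_bohrGroup (χ : CircleDual G) : Continuous fun x : BohrGroup G => χ x := by
  let t : AddGroupTopology G :=
    { toTopologicalSpace := .induced χ inferInstance
      toIsTopologicalAddGroup := topologicalAddGroup_induced χ }
  have ht : t.IsPrecompact := by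
    let _ : TopologicalSpace G := t.toTopologicalSpace
    have _ : IsTopologicalAddGroup G := t.toIsTopologicalAddGroup
    let u : UniformSpace G := IsTopologicalAddGroup.rightUniformSpace G
    have hu : IsUniformAddGroup G := isUniformAddGroup_of_addCommGroup
    refine (@compactSpace_completion_iff_totallyBounded G u).2 ?_
    have hcomap : u = UniformSpace.comap χ inferInstance :=
      IsUniformAddGroup.ext hu (IsUniformAddGroup.comap χ) rfl
    have hχ : IsUniformInducing χ := ⟨by rw [hcomap]; rfl⟩
    have h := totallyBounded_preimage hχ
      (isCompact_univ (X := AddCircle (1 : ℝ))).totallyBounded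
    simpa using h
  have hle : (bohrTopology G).toTopologicalSpace ≤ .induced χ inferInstance :=
    (isLeast_bohrTopology G).2 ht
  exact continuous_iff_le_induced.2 hle

theorem uniformContinuous_bohrGroup (χ : CircleDual G) :
    UniformContinuous fun x : BohrGroup G => χ x :=
  uniformContinuous_addMonoidHom_of_continuous
    (f := (show BohrGroup G →+ AddCircle (1 : ℝ) from (χ : G →+ AddCircle (1 : ℝ))))
    χ.continuous_bohrGroup

theorem exists_continuous_extension (χ : CircleDual G) :
    ∃ f : BohrCompactification G → AddCircle (1 : ℝ), Continuous f ∧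
      ∀ x, f (BohrCompactification.of G x) = χ x :=
  ⟨Completion.extension fun x : BohrGroup G => χ x, Completion.continuous_extension,
    fun x => Completion.extension_coe χ.uniformContinuous_bohrGroup x⟩

theorem exists_of_notMem {H : AddSubgroup G} {x : G} (hx : x ∉ H) :
    ∃ χ : CircleDual G, χ x ≠ 0 ∧ ∀ h ∈ H, χ h = 0 := by
  have h0 : (QuotientAddGroup.mk' H) x ≠ 0 := by
    rwa [Ne, QuotientAddGroup.mk'_apply, QuotientAddGroup.eq_zero_iff]
  obtain ⟨c, hc⟩ := exists_apply_ne_zero h0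
  refine ⟨AddMonoidHom.comp c (QuotientAddGroup.mk' H), hc, fun h hh => ?_⟩
  change c (QuotientAddGroup.mk' H h) = 0
  rw [QuotientAddGroup.mk'_apply, (QuotientAddGroup.eq_zero_iff h).2 hh, map_zero]

end CircleDual

/-! ### Closures, sequences and compact sets in bG -/

namespace BohrCompactification

variable {G : Type*} [AddCommGroup G]

theorem of_injective : Function.Injective (of G) := by
  rw [injective_iff_map_eq_zero]
  intro x hx
  by_contra h0
  obtain ⟨χ, hχ⟩ := CircleDual.exists_apply_ne_zero h0
  obtain ⟨f, -, hf⟩ := χ.exists_continuous_extension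
  exact hχ (by rw [← hf, hx, ← map_zero (of G), hf, map_zero])

theorem two_pow_continuum_le_mk_closure {X : Set G} (hX : X.Infinite) :
    2 ^ Cardinal.continuum ≤ Cardinal.mk (closure (of G '' X)) := by
  obtain ⟨y, K, hyX, hK, hdisj, hy⟩ := CircleDual.exists_interpolating_seq hX
  obtain ⟨I, hI⟩ := exists_independent_family
  choose χ hχ using fun r => hy (I r)
  choose f hfc hf using fun r => (χ r).exists_continuous_extension
  have hp : ∀ τ : Set ℕ → Bool, ∃ p ∈ closure (of G '' X), ∀ r, f r p ∈ K (τ r) := by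
    intro τ
    -- Independence of `I` is the finite intersection property.
    obtain ⟨p, hp, hpK⟩ := (isClosed_closure (s := of G '' X)).isCompact.inter_iInter_nonempty
      (fun r => f r ⁻¹' K (τ r)) (fun r => (hK _).preimage (hfc r)) (fun R => by
        obtain ⟨n, hn⟩ := hI R τ
        refine ⟨of G (y n), subset_closure ⟨_, hyX n, rfl⟩, Set.mem_iInter₂.2 fun r hr => ?_⟩
        rw [Set.mem_preimage, hf, ← hn r hr]
        exact hχ r n)
    exact ⟨p, hp, Set.mem_iInter.1 hpK⟩
  choose p hpX hpK using hp
  have hinj : Function.Injective fun τ => (⟨p τ, hpX τ⟩ : closure (of G '' X)) := by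
    intro τ σ h
    have hpe : p τ = p σ := congrArg Subtype.val h
    funext r
    have h1 := hpK τ r
    have h2 := hpK σ r
    rw [hpe] at h1
    generalize τ r = a at h1 ⊢
    generalize σ r = b at h2 ⊢
    cases a <;> cases b
    · rfl
    · exact (Set.disjoint_left.1 hdisj h2 h1).elim
    · exact (Set.disjoint_left.1 hdisj h1 h2).elim
    · rfl
  simpa using Cardinal.lift_mk_le_lift_mk_of_injective hinj

theorem finite_of_countable_closure {X : Set G} (hX : (closure (of G '' X)).Countable) :
    X.Finite := by
  by_contra hinf
  have h1 := (two_pow_continuum_le_mk_closure hinf).trans (Cardinal.le_aleph0_iff_set_countable.2 hX)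
  exact absurd h1 (not_le.2 (Cardinal.aleph0_lt_continuum.trans (Cardinal.cantor _)))

theorem eventually_eq_of_tendsto {x : ℕ → G} {p : BohrCompactification G}
    (hx : Tendsto (fun n => of G (x n)) atTop (𝓝 p)) : ∃ N, ∀ n, N ≤ n → x n = x N := by
  have hsub : closure (of G '' Set.range x) ⊆ insert p (Set.range fun n => of G (x n)) := by
    refine closure_minimal ?_ hx.isCompact_insert_range.isClosed
    rw [← Set.range_comp]
    exact Set.subset_insert _ _
  have hfin : (Set.range x).Finite :=
    finite_of_countable_closure (((Set.countable_range _).insert p).mono hsub)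
  -- The finitely many values other than p form a closed set, which the sequence eventually leaves.
  have hfin' : (of G '' Set.range x \ {p}).Finite := (hfin.image _).sdiff
  have hev : ∀ᶠ n in atTop, of G (x n) = p := by
    filter_upwards [hx (hfin'.isClosed.isOpen_compl.mem_nhds fun h => h.2 rfl)] with n hn
    by_contra hne
    exact hn ⟨⟨_, ⟨n, rfl⟩, rfl⟩, hne⟩
  obtain ⟨N, hN⟩ := eventually_atTop.1 hev
  exact ⟨N, fun n hn => of_injective ((hN n hn).trans (hN N le_rfl).symm)⟩

theorem countable_closure_of_isCompact {K : Set (BohrGroup G)} (hK : IsCompact K)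
    {X : Set G} (hX : X.Countable) (hXK : BohrGroup.of G '' X ⊆ K) :
    (closure (of G '' X)).Countable := by
  let H : AddSubgroup G := (Submodule.span ℤ X).toAddSubgroup
  have hH : (H : Set G).Countable := by
    have : Countable X := hX
    change (Submodule.span ℤ X : Set G).Countable
    rw [← Subtype.range_coe (s := X), ← Finsupp.range_linearCombination, LinearMap.coe_range]
    exact Set.countable_range _
  refine (hH.image (of G)).mono fun p hp => ?_
  have hsub : closure (of G '' X) ⊆ ((↑) : BohrGroup G → BohrCompactification G) '' K := by
    refine closure_minimal ?_ (hK.image (Completion.continuous_coe _)).isClosed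
    rintro _ ⟨x, hx, rfl⟩
    exact ⟨BohrGroup.of G x, hXK ⟨x, hx, rfl⟩, rfl⟩
  obtain ⟨g, -, rfl⟩ := hsub hp
  by_contra hg
  have hgH : (BohrGroup.of G).symm g ∉ H := fun h => hg ⟨_, h, rfl⟩
  obtain ⟨χ, hχ, hχH⟩ := CircleDual.exists_of_notMem hgH
  obtain ⟨f, hfc, hf⟩ := χ.exists_continuous_extension
  have hcl : closure (of G '' X) ⊆ f ⁻¹' {0} := by
    refine closure_minimal ?_ (isClosed_singleton.preimage hfc)
    rintro _ ⟨x, hx, rfl⟩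
    rw [Set.mem_preimage, hf]
    exact hχH x (Submodule.subset_span hx)
  exact hχ ((hf _).symm.trans (hcl hp))

theorem finite_of_isCompact {K : Set (BohrGroup G)} (hK : IsCompact K) : K.Finite := by
  by_contra hinf
  obtain ⟨f, hf⟩ := Set.Infinite.natEmbedding K hinf
  let x : ℕ → G := fun n => (BohrGroup.of G).symm (f n)
  have hx : Function.Injective x := fun m n h =>
    hf (Subtype.ext ((BohrGroup.of G).symm.injective h))
  refine Set.infinite_range_of_injective hx (finite_of_countable_closure
    (countable_closure_of_isCompact hK (Set.countable_range x) ?_))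
  rintro _ ⟨_, ⟨n, rfl⟩, rfl⟩
  exact (f n).2

end BohrCompactification

theorem mainTheorem10 {G : Type*} [AddCommGroup G] :
    (∀ X : Set G, X.Infinite →
      2 ^ Cardinal.continuum ≤
        Cardinal.mk (closure (BohrCompactification.of G '' X) : Set (BohrCompactification G))) ∧
    (∀ (x : ℕ → G) (p : BohrCompactification G),
      Tendsto (fun n => BohrCompactification.of G (x n)) atTop (𝓝 p) →
        ∃ N, ∀ n, N ≤ n → x n = x N) ∧
    (∀ K : Set (BohrGroup G), IsCompact K → K.Finite) := by
  exact ⟨fun X hX => BohrCompactification.two_pow_continuum_le_mk_closure hX,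
    fun x p hx => BohrCompactification.eventually_eq_of_tendsto hx,
    fun K hK => BohrCompactification.finite_of_isCompact hK⟩
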